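/- Let $G$ be a simple graph (finite or infinite), and let $P$ be a path of length three (three edges, four distinct vertices) in $G$ whose two internal vertices have degree two in $G$ and whose two end vertices are adjacent in $G$. Let $G\setminus P$ be the induced subgraph of $G$ on the vertices not in $P$, and for a graph $H$ let $\mathrm{Ind}(H)$ be its independence complex, the simplicial complex whose faces are the finite independent sets of vertices of $H$. Then (the geometric realization of) $\mathrm{Ind}(G)$ is homotopy equivalent to the suspension of (the geometric realization of) $\mathrm{Ind}(G\setminus P)$. Here geometric realizations carry the weak topology, and $\mathrm{susp}(X)$ is the unreduced suspension, obtained from $X\times[0,1]$ together with two poles by gluing $X\times\{0\}$ to one pole and $X\times\{1\}$ to the other; in particular $\mathrm{susp}(\emptyset)=S^0$. -/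

import Mathlib

/-- The independence complex `Ind(G)`: the abstract simplicial complex on the vertices of `G` whose
faces are the nonempty finite independent sets of `G`. -/
def SimpleGraph.indComplex {V : Type*} (G : SimpleGraph V) : AbstractSimplicialComplex V where
  faces := {s | s.Nonempty ∧ G.IsIndepSet (s : Set V)}
  isRelLowerSet_faces := fun _ hs =>
    ⟨hs.1, fun _ hts ht => ⟨ht, Set.Pairwise.mono (Finset.coe_subset.2 hts) hs.2⟩⟩
  singleton_mem := fun v => ⟨Finset.singleton_nonempty v, by simp [SimpleGraph.IsIndepSet]⟩

/-- The points of the geometric realization of an abstract simplicial complex: the formal convex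
combinations of vertices (barycentric coordinates) whose support is a face. -/
structure GeomRealization {V : Type*} (K : AbstractSimplicialComplex V) where
  weight : V →₀ ℝ
  weight_nonneg : ∀ v, 0 ≤ weight v
  sum_weight : (weight.sum fun _ t => t) = 1
  support_mem : weight.support ∈ K.faces

/-- The closed simplex spanned by a finite set `s` in the realization of `K`: the points whose
support is contained in `s`. -/
def GeomRealization.ClosedSimplex {V : Type*} (K : AbstractSimplicialComplex V) (s : Finset V) :
    Type _ :=
  {x : GeomRealization K // x.weight.support ⊆ s}

/-- The Euclidean topology of a closed simplex, given by the barycentric coordinates. -/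
instance GeomRealization.ClosedSimplex.instTopologicalSpace {V : Type*}
    (K : AbstractSimplicialComplex V) (s : Finset V) :
    TopologicalSpace (GeomRealization.ClosedSimplex K s) :=
  TopologicalSpace.induced (fun x v => x.1.weight v : _ → V → ℝ) Pi.topologicalSpace

/-- The inclusion of a closed simplex into the realization. -/
def GeomRealization.ClosedSimplex.incl {V : Type*} (K : AbstractSimplicialComplex V)
    (s : Finset V) (x : GeomRealization.ClosedSimplex K s) : GeomRealization K :=
  x.1

/-- The weak (coherent) topology: a subset of the realization is open exactly when, for every face
`s`, its intersection with the closed simplex of `s` is open in that simplex. -/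
instance GeomRealization.instTopologicalSpace {V : Type*} (K : AbstractSimplicialComplex V) :
    TopologicalSpace (GeomRealization K) :=
  ⨆ s ∈ K.faces, TopologicalSpace.coinduced (GeomRealization.ClosedSimplex.incl K s) inferInstance

/-- The gluing relation of the suspension: the bottom `X × {0}` of the cylinder is collapsed to the
pole `false`, the top `X × {1}` to the pole `true`. -/
inductive SuspensionRel (X : Type*) : (X × unitInterval) ⊕ Bool → (X × unitInterval) ⊕ Bool → Prop
  | bottom (x : X) : SuspensionRel X (Sum.inl (x, 0)) (Sum.inr false)
  | top (x : X) : SuspensionRel X (Sum.inl (x, 1)) (Sum.inr true)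

/-- The (unreduced) suspension of a topological space, with the quotient topology. Both poles are
always present, so the suspension of the empty space is the two-point sphere `S⁰`. -/
def Suspension (X : Type*) : Type _ := Quot (SuspensionRel X)

instance Suspension.instTopologicalSpace (X : Type*) [TopologicalSpace X] :
    TopologicalSpace (Suspension X) :=
  inferInstanceAs (TopologicalSpace (Quot (SuspensionRel X)))

/-!
The two inner vertices `b`, `c` of the path `a, b, c, d` have no neighbours outside the four-cycle
`a b c d`. Hence an independent set containing `a` stays independent when `c` is added, and one
containing `d` stays independent when `b` is added: the folding `a ↦ c`, `d ↦ b` sends every face of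
`Ind(G)` into a common face with itself, so `Ind(G)` deformation retracts onto the part of it
spanned by `b`, `c` and the set `S` of vertices off the path. As `b` and `c` are adjacent to each
other and to no vertex of `S`, that part is the suspension of `Ind(G[S])` with poles `b` and `c`.

The two steps are carried out at once. `GeomRealization.ofSusp` includes the suspension in `Ind(G)`,
and `GeomRealization.toSusp` folds, normalises the part over `S`, and takes as height a function
that is locally constant near the poles, which makes its continuity there immediate. The composite
on `Ind(G)` is contiguous to the identity (`GeomRealization.ofSusp_comp_toSusp_homotopic`); the
composite on the suspension only stretches the height (`GeomRealization.toSusp_ofSusp`).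

The weak topology enters through two criteria. A map out of a realization times `[0, 1]` is
continuous if it is so on each closed simplex times `[0, 1]`
(`GeomRealization.continuous_prod_dom`). A map into a realization whose supports lie in a fixed
finite set of vertices is continuous if its coordinates are
(`GeomRealization.continuous_of_support_subset`).
-/

/-! ### Continuity of maps into and out of a geometric realization -/

namespace GeomRealization

variable {V W : Type*} {K : AbstractSimplicialComplex V} {L : AbstractSimplicialComplex W}

theorem ext_weight {x y : GeomRealization K} (h : ∀ v, x.weight v = y.weight v) : x = y := by
  cases x
  cases y
  congr
  exact Finsupp.ext h

theorem degree_smul (r : ℝ) (w : V →₀ ℝ) : (r • w).degree = r * w.degree := by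
  change ((r • w).sum fun _ t => t) = r * w.sum fun _ t => t
  rw [Finsupp.sum_smul_index fun _ => rfl, Finsupp.mul_sum]

theorem degree_weight (x : GeomRealization K) : x.weight.degree = 1 := x.sum_weight

/-- A point of the realization given by a nonnegative weight function of total mass `1` whose
support is merely contained in some face. -/
def ofWeight (w : V →₀ ℝ) (h0 : ∀ v, 0 ≤ w v) (h1 : w.degree = 1)
    (h : ∃ s ∈ K.faces, w.support ⊆ s) : GeomRealization K where
  weight := w
  weight_nonneg := h0
  sum_weight := h1
  support_mem := by
    obtain ⟨s, hs, hws⟩ := h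
    refine K.isRelLowerSet_faces.mem_of_le hs hws ?_
    rw [Finset.nonempty_iff_ne_empty, Ne, Finsupp.support_eq_empty]
    rintro rfl
    simp at h1

theorem continuous_dom {Z : Type*} [TopologicalSpace Z] {f : GeomRealization K → Z}
    (h : ∀ s ∈ K.faces, Continuous fun x : ClosedSimplex K s => f x.1) : Continuous f :=
  continuous_iSup_dom.2 fun s => continuous_iSup_dom.2 fun hs => continuous_coinduced_dom.2 (h s hs)

/-- The weak topology is compatible with products with a locally compact factor: by currying, the
claim becomes continuity of a map from the realization to a mapping space. -/
theorem continuous_prod_dom {T Z : Type*} [TopologicalSpace T] [LocallyCompactSpace T]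
    [TopologicalSpace Z] {f : GeomRealization K × T → Z}
    (h : ∀ s ∈ K.faces, Continuous fun p : ClosedSimplex K s × T => f (p.1.1, p.2)) :
    Continuous f := by
  have hx : ∀ x : GeomRealization K, Continuous fun t => f (x, t) := fun x =>
    let x' : ClosedSimplex K x.weight.support := ⟨x, subset_rfl⟩
    (h _ x.support_mem).comp (Continuous.prodMk_right x')
  have hc : Continuous fun x : GeomRealization K => (⟨fun t => f (x, t), hx x⟩ : C(T, Z)) :=
    continuous_dom fun s hs => ContinuousMap.continuous_of_continuous_uncurry _ (h s hs)
  exact ContinuousMap.continuous_uncurry_of_continuous ⟨_, hc⟩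

theorem continuous_closedSimplex_weight (s : Finset V) (v : V) :
    Continuous fun x : ClosedSimplex K s => x.1.weight v :=
  (continuous_apply v).comp continuous_induced_dom

theorem continuous_weight (v : V) : Continuous fun x : GeomRealization K => x.weight v :=
  continuous_dom fun s _ => continuous_closedSimplex_weight s v

theorem continuous_incl {s : Finset V} (hs : s ∈ K.faces) :
    Continuous (ClosedSimplex.incl K s) :=
  continuous_iff_coinduced_le.2 (le_iSup₂_of_le s hs le_rfl)

/-- Maps whose supports all lie in one finite vertex set may be tested coordinatewise, although the
weak topology is in general finer than the topology of the coordinates: the domain is covered by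
the finitely many closed sets of points sent to a given simplex. -/
theorem continuous_of_support_subset {Y : Type*} [TopologicalSpace Y] {f : Y → GeomRealization K}
    (F : Finset V) (hF : ∀ y, (f y).weight.support ⊆ F)
    (hf : ∀ v, Continuous fun y => (f y).weight v) : Continuous f := by
  let ι := {s : Finset V // s ∈ F.powerset ∧ s ∈ K.faces}
  have : Finite ι := ((F.powerset.finite_toSet).subset fun s hs => hs.1).to_subtype
  have hmem : ∀ (s : Finset V) (y : Y),
      (f y).weight.support ⊆ s ↔ ∀ v, v ∉ s → (f y).weight v = 0 := by
    intro s y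
    simp only [Finset.subset_iff, Finsupp.mem_support_iff]
    exact forall_congr' fun v => not_imp_comm
  refine (locallyFinite_of_finite fun s : ι => {y | (f y).weight.support ⊆ s.1}).continuous
    ?_ ?_ ?_
  · refine Set.eq_univ_of_forall fun y => Set.mem_iUnion.2
      ⟨⟨_, Finset.mem_powerset.2 (hF y), (f y).support_mem⟩, subset_rfl (α := Finset V)⟩
  · intro s
    simp only [hmem, Set.ofPred_forall]
    exact isClosed_iInter fun v => isClosed_iInter fun _ => isClosed_eq (hf v) continuous_const
  · intro s
    rw [continuousOn_iff_continuous_domRestrict]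
    let e : {y | (f y).weight.support ⊆ s.1} → ClosedSimplex K s.1 := fun y => ⟨f y.1, y.2⟩
    have he : Continuous e :=
      continuous_induced_rng.2
        (continuous_pi fun v => (hf v).comp continuous_subtype_val)
    exact (continuous_incl s.2.2).comp he

/-! ### Straight-line homotopies -/

/-- The point dividing the segment between two points of a common simplex in the ratio `t`. -/
noncomputable def segmentPoint (x y : GeomRealization K)
    (h : ∃ s ∈ K.faces, x.weight.support ⊆ s ∧ y.weight.support ⊆ s) (t : unitInterval) :
    GeomRealization K :=
  ofWeight ((1 - t : ℝ) • x.weight + (t : ℝ) • y.weight)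
    (fun v => by
      have := x.weight_nonneg v
      have := y.weight_nonneg v
      have := t.2.1
      have := sub_nonneg.2 t.2.2
      simp only [Finsupp.add_apply, Finsupp.smul_apply, smul_eq_mul]
      positivity)
    (by simp [degree_smul, degree_weight])
    (by
      classical
      obtain ⟨s, hs, hx, hy⟩ := h
      exact ⟨s, hs, Finsupp.support_add.trans (Finset.union_subset
        (Finsupp.support_smul.trans hx) (Finsupp.support_smul.trans hy))⟩)

theorem segmentPoint_weight (x y : GeomRealization K)
    (h : ∃ s ∈ K.faces, x.weight.support ⊆ s ∧ y.weight.support ⊆ s) (t : unitInterval) (v : V) :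
    (segmentPoint x y h t).weight v = (1 - t) * x.weight v + t * y.weight v := by
  simp [segmentPoint, ofWeight]

/-- Contiguous maps are homotopic. The finiteness hypothesis makes the straight-line homotopy
continuous for the weak topology. -/
theorem homotopic_of_contiguous (f g : C(GeomRealization K, GeomRealization L))
    (hfin : ∀ s ∈ K.faces, ∃ F : Finset W, ∀ x : GeomRealization K, x.weight.support ⊆ s →
      (f x).weight.support ⊆ F ∧ (g x).weight.support ⊆ F)
    (hfg : ∀ x, ∃ s ∈ L.faces, (f x).weight.support ⊆ s ∧ (g x).weight.support ⊆ s) :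
    f.Homotopic g := by
  let H : GeomRealization K × unitInterval → GeomRealization L :=
    fun p => segmentPoint (f p.1) (g p.1) (hfg p.1) p.2
  have hH : ∀ p v, (H p).weight v = (1 - p.2) * (f p.1).weight v + p.2 * (g p.1).weight v :=
    fun p v => segmentPoint_weight _ _ _ _ _
  have hc : Continuous H := by
    refine continuous_prod_dom fun s hs => ?_
    obtain ⟨F, hF⟩ := hfin s hs
    refine continuous_of_support_subset F (fun p v hv => ?_) fun v => ?_
    · by_contra hvF
      have h1 : (f p.1.1).weight v = 0 :=
        Finsupp.notMem_support_iff.1 fun h => hvF ((hF p.1.1 p.1.2).1 h)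
      have h2 : (g p.1.1).weight v = 0 :=
        Finsupp.notMem_support_iff.1 fun h => hvF ((hF p.1.1 p.1.2).2 h)
      rw [Finsupp.mem_support_iff, hH, h1, h2] at hv
      simp at hv
    · simp only [hH]
      have hi : Continuous fun p : ClosedSimplex K s × unitInterval => p.1.1 :=
        (continuous_incl hs).comp continuous_fst
      have h1 := ((continuous_weight v).comp f.continuous).comp hi
      have h2 := ((continuous_weight v).comp g.continuous).comp hi
      have ht : Continuous fun p : ClosedSimplex K s × unitInterval => (p.2 : ℝ) :=
        continuous_subtype_val.comp continuous_snd
      exact ((continuous_const.sub ht).mul h1).add (ht.mul h2)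
  exact ⟨{  toFun := fun p => H (p.2, p.1)
            continuous_toFun := hc.comp (continuous_snd.prodMk continuous_fst)
            map_zero_left := fun x => ext_weight fun v => by rw [hH]; simp
            map_one_left := fun x => ext_weight fun v => by rw [hH]; simp }⟩

end GeomRealization

/-! ### Stretching a suspension -/

namespace Suspension

variable (X : Type*)

/-- The gluing map onto the suspension. -/
def mk (p : (X × unitInterval) ⊕ Bool) : Suspension X := Quot.mk _ p

variable {X}

theorem mk_zero (x : X) : mk X (Sum.inl (x, 0)) = mk X (Sum.inr false) :=
  Quot.sound (.bottom x)

theorem mk_one (x : X) : mk X (Sum.inl (x, 1)) = mk X (Sum.inr true) :=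
  Quot.sound (.top x)

variable (X)

theorem isQuotientMap_mk [TopologicalSpace X] : Topology.IsQuotientMap (mk X) :=
  isQuotientMap_quot_mk

/-- The homotopy from the identity of `[0, 1]` to the map that stretches `[1/4, 3/4]` onto `[0, 1]`
and collapses the rest to the end points. -/
noncomputable def stretch (t s : unitInterval) : unitInterval :=
  Set.projIcc 0 1 zero_le_one (s + t * (s - 1 / 2) : ℝ)

theorem stretch_at_zero (t : unitInterval) : stretch t 0 = 0 :=
  Set.projIcc_of_le_left _ (by have := t.2.1; simp only [Set.Icc.coe_zero]; linarith)

theorem stretch_at_one (t : unitInterval) : stretch t 1 = 1 :=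
  Set.projIcc_of_right_le _ (by have := t.2.1; simp only [Set.Icc.coe_one]; linarith)

theorem stretch_zero (s : unitInterval) : stretch 0 s = s := by
  simp [stretch]

theorem continuous_stretch :
    Continuous fun p : unitInterval × unitInterval => stretch p.1 p.2 :=
  continuous_projIcc.comp (by fun_prop)

/-- The self-map of the suspension that applies `stretch t` to the height. -/
noncomputable def stretchMap (t : unitInterval) : Suspension X → Suspension X :=
  Quot.lift (Sum.elim (fun p => mk X (Sum.inl (p.1, stretch t p.2))) fun e => mk X (Sum.inr e)) (by
    rintro _ _ (x | x)
    · simp only [Sum.elim_inl, Sum.elim_inr, stretch_at_zero, mk_zero]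
    · simp only [Sum.elim_inl, Sum.elim_inr, stretch_at_one, mk_one])

theorem continuous_stretchMap [TopologicalSpace X] :
    Continuous fun p : Suspension X × unitInterval => stretchMap X p.2 p.1 := by
  have hq := (isQuotientMap_mk X).continuous
  refine (isQuotientMap_mk X).continuous_lift_prod_left ?_
  rw [← Homeomorph.sumProdDistrib.symm.comp_continuous_iff', continuous_sum_dom]
  constructor
  · refine hq.comp (continuous_inl.comp (Continuous.prodMk
      (continuous_fst.comp continuous_fst) ?_))
    exact continuous_stretch.comp
      (continuous_snd.prodMk (continuous_snd.comp continuous_fst))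
  · exact hq.comp (continuous_inr.comp continuous_fst)

theorem stretchMap_one_homotopic [TopologicalSpace X] (f : C(Suspension X, Suspension X))
    (hf : ∀ q, f q = stretchMap X 1 q) : f.Homotopic (ContinuousMap.id _) := by
  refine ContinuousMap.Homotopic.symm
    ⟨{  toFun := fun p => stretchMap X p.1 p.2
        continuous_toFun := (continuous_stretchMap X).comp continuous_swap
        map_zero_left := ?_
        map_one_left := fun q => (hf q).symm }⟩
  rintro ⟨⟨x, s⟩ | e⟩
  · exact congrArg (fun r => mk X (Sum.inl (x, r))) (stretch_zero s)
  · rfl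

end Suspension

/-! ### The four-cycle spanned by the path -/

/-- The vertices `a, b, c, d` form a four-cycle of `G` in which `b` and `c` have no further
neighbours, and `S` is the set of the remaining vertices of `G`. -/
structure SimpleGraph.IsFoldableSquare {V : Type*} (G : SimpleGraph V) (a b c d : V) (S : Set V) :
    Prop where
  adj_ab : G.Adj a b
  adj_bc : G.Adj b c
  adj_cd : G.Adj c d
  adj_ad : G.Adj a d
  ne_ac : a ≠ c
  ne_bd : b ≠ d
  eq_of_adj_b : ∀ u, G.Adj b u → u = a ∨ u = c
  eq_of_adj_c : ∀ u, G.Adj c u → u = b ∨ u = d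
  mem_iff : ∀ v, v ∈ S ↔ v ≠ a ∧ v ≠ b ∧ v ≠ c ∧ v ≠ d

theorem SimpleGraph.IsFoldableSquare.of_path {V : Type*} (G : SimpleGraph V) {a d : V}
    (P : G.Walk a d) (hP : P.IsPath) (hlen : P.length = 3)
    (hdeg : ∀ v ∈ P.support, v ≠ a → v ≠ d → (G.neighborSet v).encard = 2) (had : G.Adj a d) :
    ∃ b c, G.IsFoldableSquare a b c d {v | v ∉ P.support} := by
  have key : ∀ {v x y}, (G.neighborSet v).encard = 2 → G.Adj v x → G.Adj v y → x ≠ y →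
      ∀ u, G.Adj v u → u = x ∨ u = y := by
    intro v x y hv hx hy hxy u hu
    have hsub : ({x, y} : Set V) ⊆ G.neighborSet v := by
      rintro z (rfl | rfl)
      · exact hx
      · exact hy
    have := (Set.toFinite {x, y}).eq_of_subset_of_encard_le hsub (by rw [hv, Set.encard_pair hxy])
    have hu' : u ∈ ({x, y} : Set V) := this ▸ hu
    exact hu'
  match P, hP, hlen, hdeg with
  | .cons (v := b) hab (.cons (v := c) hbc (.cons hcd .nil)), hP, _, hdeg =>
    have hnd := hP.support_nodup
    simp only [SimpleGraph.Walk.support_cons, SimpleGraph.Walk.support_nil, List.nodup_cons,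
      List.mem_cons, List.not_mem_nil, or_false, not_or] at hnd
    obtain ⟨⟨hnab, hnac, hnad⟩, ⟨hnbc, hnbd⟩, hncd, -⟩ := hnd
    refine ⟨b, c, hab, hbc, hcd, had, hnac, hnbd, ?_, ?_, ?_⟩
    · exact key (hdeg b (by simp) (Ne.symm hnab) hnbd) hab.symm hbc hnac
    · exact key (hdeg c (by simp) (Ne.symm hnac) hncd) hbc.symm hcd hnbd
    · intro v
      simp

namespace GeomRealization

variable {V : Type*} {G : SimpleGraph V} {a b c d : V} {S : Set V}

theorem notAdj_of_weight_ne_zero (y : GeomRealization G.indComplex) {u v : V}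
    (hu : y.weight u ≠ 0) (hv : y.weight v ≠ 0) : ¬ G.Adj u v := fun h =>
  y.support_mem.2 (Finsupp.mem_support_iff.2 hu) (Finsupp.mem_support_iff.2 hv) h.ne h

/-- The vertex `v` as a point of the realization. -/
noncomputable def vertex (K : AbstractSimplicialComplex V) (v : V) : GeomRealization K where
  weight := .single v 1
  weight_nonneg u := by
    classical
    rw [Finsupp.single_apply]
    split_ifs <;> norm_num
  sum_weight := Finsupp.degree_single v 1
  support_mem := by
    rw [Finsupp.support_single v one_ne_zero]
    exact K.singleton_mem v

/-! ### From the suspension to the independence complex -/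

theorem embDomain_subtype_of_mem (w : S →₀ ℝ) {v : V} (h : v ∈ S) :
    w.embDomain (.subtype (· ∈ S)) v = w ⟨v, h⟩ :=
  Finsupp.embDomain_apply_self (.subtype (· ∈ S)) w ⟨v, h⟩

theorem embDomain_subtype_of_notMem (w : S →₀ ℝ) {v : V} (h : v ∉ S) :
    w.embDomain (.subtype (· ∈ S)) v = 0 :=
  Finsupp.embDomain_of_notMem_range _ _ _ (by simpa using h)

theorem degree_embDomain_subtype (w : S →₀ ℝ) :
    (w.embDomain (.subtype (· ∈ S))).degree = w.degree :=
  Finsupp.sum_embDomain (f := .subtype (· ∈ S)) (v := w) (g := fun _ t => t)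

/-- The weights of the point at height `s` on the broken line from `b` through the point of
weights `w` to `c`. -/
noncomputable def suspWeight (b c : V) (w : S →₀ ℝ) (s : ℝ) : V →₀ ℝ :=
  Finsupp.single b (max (1 - 2 * s) 0) + Finsupp.single c (max (2 * s - 1) 0) +
    (1 - |2 * s - 1|) • w.embDomain (.subtype (· ∈ S))

theorem suspWeight_b (h : G.IsFoldableSquare a b c d S) (w : S →₀ ℝ) (s : ℝ) :
    suspWeight b c w s b = max (1 - 2 * s) 0 := by
  have hb : b ∉ S := fun hb => ((h.mem_iff b).1 hb).2.1 rfl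
  simp [suspWeight, h.adj_bc.ne, embDomain_subtype_of_notMem w hb]

theorem suspWeight_c (h : G.IsFoldableSquare a b c d S) (w : S →₀ ℝ) (s : ℝ) :
    suspWeight b c w s c = max (2 * s - 1) 0 := by
  have hc : c ∉ S := fun hc => ((h.mem_iff c).1 hc).2.2.1 rfl
  simp [suspWeight, h.adj_bc.ne', embDomain_subtype_of_notMem w hc]

theorem suspWeight_a (h : G.IsFoldableSquare a b c d S) (w : S →₀ ℝ) (s : ℝ) :
    suspWeight b c w s a = 0 := by
  have ha : a ∉ S := fun ha => ((h.mem_iff a).1 ha).1 rfl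
  simp [suspWeight, h.adj_ab.ne, h.ne_ac, embDomain_subtype_of_notMem w ha]

theorem suspWeight_d (h : G.IsFoldableSquare a b c d S) (w : S →₀ ℝ) (s : ℝ) :
    suspWeight b c w s d = 0 := by
  have hd : d ∉ S := fun hd => ((h.mem_iff d).1 hd).2.2.2 rfl
  simp [suspWeight, h.ne_bd.symm, h.adj_cd.ne', embDomain_subtype_of_notMem w hd]

theorem suspWeight_of_mem (h : G.IsFoldableSquare a b c d S) (w : S →₀ ℝ) (s : ℝ) {v : V}
    (hv : v ∈ S) : suspWeight b c w s v = (1 - |2 * s - 1|) * w ⟨v, hv⟩ := by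
  have := (h.mem_iff v).1 hv
  simp [suspWeight, this.2.1, this.2.2.1, embDomain_subtype_of_mem w hv]

theorem suspWeight_ne_zero (h : G.IsFoldableSquare a b c d S) {w : S →₀ ℝ} {s : ℝ} {v : V}
    (hv : suspWeight b c w s v ≠ 0) :
    v = b ∧ s < 1 / 2 ∨ v = c ∧ 1 / 2 < s ∨ ∃ hS : v ∈ S, w ⟨v, hS⟩ ≠ 0 := by
  by_cases hS : v ∈ S
  · rw [suspWeight_of_mem h w s hS] at hv
    exact .inr (.inr ⟨hS, right_ne_zero_of_mul hv⟩)
  · have hv' : v = a ∨ v = b ∨ v = c ∨ v = d := by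
      by_contra! hne
      exact hS ((h.mem_iff v).2 hne)
    rcases hv' with rfl | rfl | rfl | rfl
    · exact absurd (suspWeight_a h w s) hv
    · refine .inl ⟨rfl, ?_⟩
      by_contra! hs
      exact hv ((suspWeight_b h w s).trans (max_eq_right (by linarith)))
    · refine .inr (.inl ⟨rfl, ?_⟩)
      by_contra! hs
      exact hv ((suspWeight_c h w s).trans (max_eq_right (by linarith)))
    · exact absurd (suspWeight_d h w s) hv

theorem degree_suspWeight (b c : V) {w : S →₀ ℝ} (hw : w.degree = 1) (s : ℝ) :
    (suspWeight b c w s).degree = 1 := by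
  simp only [suspWeight, map_add, Finsupp.degree_single, degree_smul, degree_embDomain_subtype, hw]
  rcases le_total (2 * s) 1 with hs | hs
  · rw [max_eq_left (by linarith), max_eq_right (by linarith), abs_of_nonpos (by linarith)]
    ring
  · rw [max_eq_right (by linarith), max_eq_left (by linarith), abs_of_nonneg (by linarith)]
    ring

theorem suspWeight_nonneg (h : G.IsFoldableSquare a b c d S) {w : S →₀ ℝ} (hw : ∀ v, 0 ≤ w v)
    (s : unitInterval) (v : V) : 0 ≤ suspWeight b c w s v := by
  by_cases hS : v ∈ S
  · rw [suspWeight_of_mem h w s hS]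
    have : |2 * (s : ℝ) - 1| ≤ 1 := abs_le.2 ⟨by linarith [s.2.1], by linarith [s.2.2]⟩
    exact mul_nonneg (by linarith) (hw _)
  · by_contra! hneg
    rcases suspWeight_ne_zero h hneg.ne with ⟨rfl, -⟩ | ⟨rfl, -⟩ | ⟨hS', -⟩
    · exact hneg.not_ge (suspWeight_b h w s ▸ le_max_right _ _)
    · exact hneg.not_ge (suspWeight_c h w s ▸ le_max_right _ _)
    · exact hS hS'

/-- The image in `Ind(G)` of the point of height `s` over `x` in the suspension of `Ind(G[S])`:
the broken line over `x` runs from `b` through `x` to `c`. -/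
noncomputable def ofSuspPoint (h : G.IsFoldableSquare a b c d S)
    (x : GeomRealization (G.induce S).indComplex) (s : unitInterval) :
    GeomRealization G.indComplex where
  weight := suspWeight b c x.weight s
  weight_nonneg := suspWeight_nonneg h x.weight_nonneg s
  sum_weight := degree_suspWeight b c x.degree_weight s
  support_mem := by
    refine ⟨?_, fun u hu v hv _ huv => ?_⟩
    · rw [Finset.nonempty_iff_ne_empty, Ne, Finsupp.support_eq_empty]
      intro h0
      have := degree_suspWeight b c x.degree_weight s
      simp [h0] at this
    · have hnb : ∀ {u}, u ∈ S → ¬ G.Adj b u := fun hu hbu => by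
        have := (h.mem_iff _).1 hu
        rcases h.eq_of_adj_b _ hbu with rfl | rfl <;> simp at this
      have hnc : ∀ {u}, u ∈ S → ¬ G.Adj c u := fun hu hcu => by
        have := (h.mem_iff _).1 hu
        rcases h.eq_of_adj_c _ hcu with rfl | rfl <;> simp at this
      rcases suspWeight_ne_zero h (Finsupp.mem_support_iff.1 hu) with
        ⟨rfl, hs⟩ | ⟨rfl, hs⟩ | ⟨huS, hu0⟩ <;>
      rcases suspWeight_ne_zero h (Finsupp.mem_support_iff.1 hv) with
        ⟨rfl, hs'⟩ | ⟨rfl, hs'⟩ | ⟨hvS, hv0⟩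
      · exact huv.ne rfl
      · linarith
      · exact hnb hvS huv
      · linarith
      · exact huv.ne rfl
      · exact hnc hvS huv
      · exact hnb huS huv.symm
      · exact hnc huS huv.symm
      · exact x.notAdj_of_weight_ne_zero hu0 hv0 huv

theorem continuous_ofSuspPoint (h : G.IsFoldableSquare a b c d S) :
    Continuous fun p : GeomRealization (G.induce S).indComplex × unitInterval =>
      ofSuspPoint h p.1 p.2 := by
  classical
  refine continuous_prod_dom fun t ht => ?_
  refine continuous_of_support_subset ({b, c} ∪ t.map (.subtype (· ∈ S))) ?_ fun v => ?_
  · intro p v hv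
    rcases suspWeight_ne_zero h (Finsupp.mem_support_iff.1 hv) with
      ⟨rfl, -⟩ | ⟨rfl, -⟩ | ⟨hvS, hv0⟩
    · simp
    · simp
    · exact Finset.mem_union_right _ (Finset.mem_map.2
        ⟨⟨v, hvS⟩, p.1.2 (Finsupp.mem_support_iff.2 hv0), rfl⟩)
  · have hs : Continuous fun p : ClosedSimplex (G.induce S).indComplex t × unitInterval =>
        (p.2 : ℝ) := continuous_subtype_val.comp continuous_snd
    change Continuous fun p : ClosedSimplex (G.induce S).indComplex t × unitInterval =>
      suspWeight b c p.1.1.weight p.2 v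
    by_cases hS : v ∈ S
    · simp only [suspWeight_of_mem h _ _ hS]
      have hw := (continuous_closedSimplex_weight (K := (G.induce S).indComplex) t ⟨v, hS⟩).comp
        (continuous_fst (Y := unitInterval))
      exact (by fun_prop : Continuous fun p : ClosedSimplex (G.induce S).indComplex t ×
        unitInterval => 1 - |2 * (p.2 : ℝ) - 1|).mul hw
    · simp only [suspWeight, Finsupp.add_apply, Finsupp.smul_apply, Finsupp.single_apply,
        embDomain_subtype_of_notMem _ hS]
      split_ifs <;> fun_prop

/-- The map from the suspension of `Ind(G[S])` to `Ind(G)` with poles `b` and `c`. -/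
noncomputable def ofSusp (h : G.IsFoldableSquare a b c d S) :
    C(Suspension (GeomRealization (G.induce S).indComplex), GeomRealization G.indComplex) where
  toFun := Quot.lift
    (Sum.elim (fun p => ofSuspPoint h p.1 p.2)
      (fun e => vertex G.indComplex (if e then c else b)))
    (by
      rintro _ _ (x | x)
      · exact ext_weight fun v => by simp [ofSuspPoint, suspWeight, vertex]
      · exact ext_weight fun v => by norm_num [ofSuspPoint, suspWeight, vertex])
  continuous_toFun := by
    refine continuous_quot_lift _ (continuous_sum_dom.2 ⟨continuous_ofSuspPoint h, ?_⟩)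
    exact continuous_of_discreteTopology

end GeomRealization

/-! ### From the independence complex to the suspension -/

namespace GeomRealization

variable {V : Type*} {G : SimpleGraph V} {a b c d : V} {S : Set V}

/-- The height of a point of `Ind(G)`: folding `d` onto `b` and `a` onto `c` turns it into a point
of the suspension, whose height is then stretched by the factor two, so that the height is locally
constant near the poles. -/
noncomputable def height (a b c d : V) (y : GeomRealization G.indComplex) : unitInterval :=
  Set.projIcc 0 1 zero_le_one
    (1 / 2 + (y.weight c + y.weight a) - (y.weight b + y.weight d))

/-- The total weight of a point outside the four-cycle. -/
noncomputable def coreMass (a b c d : V) (y : GeomRealization G.indComplex) : ℝ :=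
  1 - (y.weight c + y.weight a) - (y.weight b + y.weight d)

theorem degree_subtypeDomain (h : G.IsFoldableSquare a b c d S)
    (y : GeomRealization G.indComplex) :
    (y.weight.subtypeDomain (· ∈ S)).degree = coreMass a b c d y := by
  have hy : y.weight = Finsupp.single a (y.weight a) + Finsupp.single b (y.weight b) +
      Finsupp.single c (y.weight c) + Finsupp.single d (y.weight d) +
      (y.weight.subtypeDomain (· ∈ S)).embDomain (.subtype (· ∈ S)) := by
    have hab := h.adj_ab.ne
    have hbc := h.adj_bc.ne
    have hcd := h.adj_cd.ne
    have had := h.adj_ad.ne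
    have hac := h.ne_ac
    have hbd := h.ne_bd
    ext v
    by_cases hS : v ∈ S
    · have := (h.mem_iff v).1 hS
      simp [embDomain_subtype_of_mem _ hS, this]
    · have hv' : v = a ∨ v = b ∨ v = c ∨ v = d := by
        by_contra! hne
        exact hS ((h.mem_iff v).2 hne)
      rw [Finsupp.add_apply, embDomain_subtype_of_notMem _ hS]
      rcases hv' with rfl | rfl | rfl | rfl <;> simp [*, Ne.symm]
  have := congrArg Finsupp.degree hy
  simp only [map_add, Finsupp.degree_single, degree_embDomain_subtype, degree_weight] at this
  rw [coreMass]
  linarith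

/-- The part of a point of `Ind(G)` outside the four-cycle, normalised to total weight `1`. -/
noncomputable def core (h : G.IsFoldableSquare a b c d S) (y : GeomRealization G.indComplex)
    (hy : 0 < coreMass a b c d y) : GeomRealization (G.induce S).indComplex where
  weight := (coreMass a b c d y)⁻¹ • y.weight.subtypeDomain (· ∈ S)
  weight_nonneg v := mul_nonneg (inv_nonneg.2 hy.le) (y.weight_nonneg v)
  sum_weight := by
    change Finsupp.degree _ = _
    rw [degree_smul, degree_subtypeDomain h, inv_mul_cancel₀ hy.ne']
  support_mem := by
    refine ⟨?_, fun u hu v hv _ huv => ?_⟩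
    · rw [Finset.nonempty_iff_ne_empty, Ne, Finsupp.support_eq_empty]
      intro h0
      have := congrArg Finsupp.degree h0
      rw [degree_smul, degree_subtypeDomain h, inv_mul_cancel₀ hy.ne'] at this
      simp at this
    · exact y.notAdj_of_weight_ne_zero (right_ne_zero_of_mul (Finsupp.mem_support_iff.1 hu))
        (right_ne_zero_of_mul (Finsupp.mem_support_iff.1 hv)) huv

theorem core_weight (h : G.IsFoldableSquare a b c d S) (y : GeomRealization G.indComplex)
    (hy : 0 < coreMass a b c d y) (v : S) :
    (core h y hy).weight v = (coreMass a b c d y)⁻¹ * y.weight v := rfl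

/-- The weights at `a`, `c` and those at `b`, `d` are not both nonzero. -/
theorem north_eq_zero_or_south_eq_zero (h : G.IsFoldableSquare a b c d S)
    (y : GeomRealization G.indComplex) :
    y.weight c + y.weight a = 0 ∨ y.weight b + y.weight d = 0 := by
  have key : ∀ {u v}, G.Adj u v → y.weight u = 0 ∨ y.weight v = 0 := by
    intro u v huv
    by_contra! hne
    exact y.notAdj_of_weight_ne_zero hne.1 hne.2 huv
  rcases key h.adj_ab with h1 | h1 <;> rcases key h.adj_bc with h2 | h2 <;>
  rcases key h.adj_cd with h3 | h3 <;> rcases key h.adj_ad with h4 | h4 <;> simp [*]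

open Classical in
/-- The underlying function of `toSusp`. Where nothing of the point lies outside
the four-cycle, it is sent to the pole of the side of the cycle on which it lies. -/
noncomputable def toSuspFun (h : G.IsFoldableSquare a b c d S)
    (y : GeomRealization G.indComplex) : Suspension (GeomRealization (G.induce S).indComplex) :=
  if hy : 0 < coreMass a b c d y then .mk _ (.inl (core h y hy, height a b c d y))
  else .mk _ (.inr (decide (0 < y.weight c + y.weight a)))

theorem toSuspFun_of_pos (h : G.IsFoldableSquare a b c d S) (y : GeomRealization G.indComplex)
    (hy : 0 < coreMass a b c d y) :
    toSuspFun h y = .mk _ (.inl (core h y hy, height a b c d y)) := dif_pos hy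

theorem toSuspFun_of_north (h : G.IsFoldableSquare a b c d S) (y : GeomRealization G.indComplex)
    (hy : 1 / 2 < y.weight c + y.weight a) : toSuspFun h y = .mk _ (.inr true) := by
  unfold toSuspFun
  split_ifs with hm
  · have hs : height a b c d y = 1 := by
      refine Set.projIcc_of_right_le _ ?_
      have := (north_eq_zero_or_south_eq_zero h y).resolve_left (by linarith)
      linarith
    rw [hs, Suspension.mk_one]
  · rw [decide_eq_true (by linarith)]

theorem toSuspFun_of_south (h : G.IsFoldableSquare a b c d S) (y : GeomRealization G.indComplex)
    (hy : 1 / 2 < y.weight b + y.weight d) : toSuspFun h y = .mk _ (.inr false) := by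
  have h0 := (north_eq_zero_or_south_eq_zero h y).resolve_right (by linarith)
  unfold toSuspFun
  split_ifs with hm
  · have hs : height a b c d y = 0 := by
      refine Set.projIcc_of_le_left _ ?_
      linarith
    rw [hs, Suspension.mk_zero]
  · rw [decide_eq_false (by linarith)]

theorem continuous_coreMass (a b c d : V) :
    Continuous (coreMass a b c d : GeomRealization G.indComplex → ℝ) := by
  have := continuous_weight (K := G.indComplex)
  unfold coreMass
  fun_prop

theorem continuous_height (a b c d : V) :
    Continuous (height a b c d : GeomRealization G.indComplex → unitInterval) := by
  have := continuous_weight (K := G.indComplex)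
  exact continuous_projIcc.comp (by fun_prop)

/-- Continuity is checked on three open sets: where the core is nonempty, and around the two poles,
where the map is constant. -/
theorem continuous_toSuspFun (h : G.IsFoldableSquare a b c d S) : Continuous (toSuspFun h) := by
  classical
  refine continuous_dom fun s hs => continuous_iff_continuousAt.2 fun x => ?_
  have hi : Continuous fun x : ClosedSimplex G.indComplex s => x.1 := continuous_incl hs
  have hw : ∀ v, Continuous fun x : ClosedSimplex G.indComplex s => x.1.weight v :=
    continuous_closedSimplex_weight s
  have hm : Continuous fun x : ClosedSimplex G.indComplex s => coreMass a b c d x.1 :=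
    (continuous_coreMass a b c d).comp hi
  by_cases hN : 1 / 2 < x.1.weight c + x.1.weight a
  · have hev := ((hw c).add (hw a)).continuousAt.eventually (lt_mem_nhds hN)
    exact (continuousAt_const (y := Suspension.mk _ (.inr true))).congr
      (hev.mono fun z hz => (toSuspFun_of_north h z.1 hz).symm)
  by_cases hS : 1 / 2 < x.1.weight b + x.1.weight d
  · have hev := ((hw b).add (hw d)).continuousAt.eventually (lt_mem_nhds hS)
    exact (continuousAt_const (y := Suspension.mk _ (.inr false))).congr
      (hev.mono fun z hz => (toSuspFun_of_south h z.1 hz).symm)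
  have hx : 0 < coreMass a b c d x.1 := by
    unfold coreMass
    rcases north_eq_zero_or_south_eq_zero h x.1 with h0 | h0 <;> linarith
  let U : Set (ClosedSimplex G.indComplex s) := {z | 0 < coreMass a b c d z.1}
  have hU : IsOpen U := isOpen_lt continuous_const hm
  suffices hc : ContinuousOn (fun z : ClosedSimplex G.indComplex s => toSuspFun h z.1) U from
    hc.continuousAt (hU.mem_nhds hx)
  rw [continuousOn_iff_continuous_domRestrict]
  have heq : U.domRestrict (fun z : ClosedSimplex G.indComplex s => toSuspFun h z.1) = fun z =>
      .mk _ (.inl (core h z.1.1 z.2, height a b c d z.1.1)) :=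
    funext fun z => toSuspFun_of_pos h z.1.1 z.2
  rw [heq]
  refine (Suspension.isQuotientMap_mk _).continuous.comp (continuous_inl.comp (.prodMk ?_ ?_))
  · refine continuous_of_support_subset (s.subtype (· ∈ S)) (fun z v hv => ?_) fun v => ?_
    · rw [Finset.mem_subtype]
      exact z.1.2 (Finsupp.mem_support_iff.2
        (right_ne_zero_of_mul (Finsupp.mem_support_iff.1 hv)))
    · simp only [core_weight]
      exact ((hm.comp continuous_subtype_val).inv₀ fun z => z.2.ne').mul
        ((hw v).comp continuous_subtype_val)
  · exact ((continuous_height a b c d).comp hi).comp continuous_subtype_val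

/-- The map from `Ind(G)` to the suspension of `Ind(G[S])`. -/
noncomputable def toSusp (h : G.IsFoldableSquare a b c d S) :
    C(GeomRealization G.indComplex, Suspension (GeomRealization (G.induce S).indComplex)) :=
  ⟨toSuspFun h, continuous_toSuspFun h⟩

/-! ### The homotopy equivalence -/

theorem ofSusp_mk_inl (h : G.IsFoldableSquare a b c d S)
    (x : GeomRealization (G.induce S).indComplex) (s : unitInterval) :
    ofSusp h (.mk _ (.inl (x, s))) = ofSuspPoint h x s := rfl

theorem ofSusp_mk_inr (h : G.IsFoldableSquare a b c d S) (e : Bool) :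
    ofSusp h (.mk _ (.inr e)) = vertex G.indComplex (if e then c else b) := rfl

/-- Going from `Ind(G)` to the suspension and back, the support of a point is replaced by part of
its image under the folding `d ↦ b`, `a ↦ c`. -/
theorem ofSusp_toSusp_weight_ne_zero (h : G.IsFoldableSquare a b c d S)
    (y : GeomRealization G.indComplex) {v : V} (hv : (ofSusp h (toSusp h y)).weight v ≠ 0) :
    v = b ∧ y.weight b + y.weight d ≠ 0 ∨ v = c ∧ y.weight c + y.weight a ≠ 0 ∨
      v ∈ S ∧ y.weight v ≠ 0 := by
  have hN := add_nonneg (y.weight_nonneg c) (y.weight_nonneg a)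
  have hS := add_nonneg (y.weight_nonneg b) (y.weight_nonneg d)
  change (ofSusp h (toSuspFun h y)).weight v ≠ 0 at hv
  by_cases hy : 0 < coreMass a b c d y
  · rw [toSuspFun_of_pos h y hy, ofSusp_mk_inl] at hv
    rcases suspWeight_ne_zero h hv with ⟨rfl, hs⟩ | ⟨rfl, hs⟩ | ⟨hvS, hv0⟩
    · refine .inl ⟨rfl, fun h0 => ?_⟩
      -- Without weight at `b` and `d` the height is at least one half.
      have : (1 / 2 : ℝ) ≤ height a v c d y :=
        le_max_of_le_right (le_min (by norm_num) (by linarith))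
      linarith
    · refine .inr (.inl ⟨rfl, fun h0 => ?_⟩)
      have : (height a b v d y : ℝ) ≤ 1 / 2 :=
        max_le (by norm_num) (min_le_of_right_le (by linarith))
      linarith
    · exact .inr (.inr ⟨hvS, right_ne_zero_of_mul hv0⟩)
  · have hm : coreMass a b c d y = 1 - (y.weight c + y.weight a) - (y.weight b + y.weight d) := rfl
    rcases north_eq_zero_or_south_eq_zero h y with h0 | h0
    · rw [toSuspFun_of_south h y (by linarith), ofSusp_mk_inr] at hv
      refine .inl ⟨?_, by linarith⟩
      by_contra hne
      simp [vertex, hne] at hv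
    · rw [toSuspFun_of_north h y (by linarith), ofSusp_mk_inr] at hv
      refine .inr (.inl ⟨?_, by linarith⟩)
      by_contra hne
      simp [vertex, hne] at hv

theorem ofSusp_comp_toSusp_homotopic (h : G.IsFoldableSquare a b c d S) :
    ((ofSusp h).comp (toSusp h)).Homotopic (ContinuousMap.id _) := by
  classical
  refine homotopic_of_contiguous _ _ (fun s _ => ⟨s ∪ {b, c}, fun y hy =>
    ⟨fun v hv => ?_, hy.trans Finset.subset_union_left⟩⟩) fun y => ?_
  · rcases ofSusp_toSusp_weight_ne_zero h y (Finsupp.mem_support_iff.1 hv) with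
      ⟨rfl, -⟩ | ⟨rfl, -⟩ | ⟨-, hv0⟩
    · simp
    · simp
    · exact Finset.mem_union_left _ (hy (Finsupp.mem_support_iff.2 hv0))
  · refine ⟨(ofSusp h (toSusp h y)).weight.support ∪ y.weight.support, ⟨?_, ?_⟩,
      Finset.subset_union_left, Finset.subset_union_right⟩
    · exact y.support_mem.1.mono Finset.subset_union_right
    · have hz := north_eq_zero_or_south_eq_zero h y
      have hnb : y.weight b + y.weight d ≠ 0 → ∀ u, y.weight u ≠ 0 → ¬ G.Adj b u := by
        intro hS u hu hbu
        have h0 := hz.resolve_right hS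
        have := y.weight_nonneg a
        have := y.weight_nonneg c
        rcases h.eq_of_adj_b _ hbu with rfl | rfl <;> exact hu (by linarith)
      have hnc : y.weight c + y.weight a ≠ 0 → ∀ u, y.weight u ≠ 0 → ¬ G.Adj c u := by
        intro hN u hu hcu
        have h0 := hz.resolve_left hN
        have := y.weight_nonneg b
        have := y.weight_nonneg d
        rcases h.eq_of_adj_c _ hcu with rfl | rfl <;> exact hu (by linarith)
      have hcases : ∀ u ∈ (ofSusp h (toSusp h y)).weight.support ∪ y.weight.support,
          u = b ∧ y.weight b + y.weight d ≠ 0 ∨ u = c ∧ y.weight c + y.weight a ≠ 0 ∨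
            y.weight u ≠ 0 := by
        intro u hu
        rcases Finset.mem_union.1 hu with hu | hu
        · exact (ofSusp_toSusp_weight_ne_zero h y (Finsupp.mem_support_iff.1 hu)).imp_right
            (Or.imp_right And.right)
        · exact .inr (.inr (Finsupp.mem_support_iff.1 hu))
      intro u hu v hv _ huv
      rcases hcases u hu with ⟨rfl, h1⟩ | ⟨rfl, h1⟩ | h1 <;>
      rcases hcases v hv with ⟨rfl, h2⟩ | ⟨rfl, h2⟩ | h2
      · exact huv.ne rfl
      · exact hz.elim h2 h1
      · exact hnb h1 v h2 huv
      · exact hz.elim h1 h2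
      · exact huv.ne rfl
      · exact hnc h1 v h2 huv
      · exact hnb h2 u h1 huv.symm
      · exact hnc h2 u h1 huv.symm
      · exact y.notAdj_of_weight_ne_zero h1 h2 huv

/-- Going from the suspension to `Ind(G)` and back fixes the base coordinate and stretches the
height by the factor two. -/
theorem toSusp_ofSusp (h : G.IsFoldableSquare a b c d S)
    (q : Suspension (GeomRealization (G.induce S).indComplex)) :
    toSusp h (ofSusp h q) = Suspension.stretchMap _ 1 q := by
  have hpole : ∀ e : Bool, toSusp h (ofSusp h (.mk _ (.inr e))) = .mk _ (.inr e) := by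
    rintro (_ | _)
    · refine toSuspFun_of_south h _ ?_
      norm_num [ofSusp_mk_inr, vertex, h.ne_bd]
    · refine toSuspFun_of_north h _ ?_
      norm_num [ofSusp_mk_inr, vertex, h.ne_ac.symm]
  obtain ⟨p, rfl⟩ := (Suspension.isQuotientMap_mk _).surjective q
  obtain ⟨x, s⟩ | e := p
  swap
  · exact hpole e
  rcases eq_or_ne s 0 with rfl | hs0
  · rw [Suspension.mk_zero]
    exact hpole false
  rcases eq_or_ne s 1 with rfl | hs1
  · rw [Suspension.mk_one]
    exact hpole true
  have h0 : (0 : ℝ) < s := s.2.1.lt_of_ne fun h => hs0 (Subtype.ext h.symm)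
  have h1 : (s : ℝ) < 1 := s.2.2.lt_of_ne fun h => hs1 (Subtype.ext h)
  have ha := suspWeight_a h x.weight s
  have hb := suspWeight_b h x.weight s
  have hc := suspWeight_c h x.weight s
  have hd := suspWeight_d h x.weight s
  have hmass : coreMass a b c d (ofSuspPoint h x s) = 1 - |2 * (s : ℝ) - 1| := by
    simp only [coreMass, ofSuspPoint, ha, hb, hc, hd]
    grind
  have hpos : 0 < coreMass a b c d (ofSuspPoint h x s) := by
    rw [hmass, sub_pos, abs_lt]
    constructor <;> linarith
  have hheight : height a b c d (ofSuspPoint h x s) = Suspension.stretch 1 s := by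
    simp only [height, ofSuspPoint, ha, hb, hc, hd, Suspension.stretch, Set.Icc.coe_one]
    congr 1
    grind
  have hcore : core h _ hpos = x := by
    refine ext_weight fun v => ?_
    rw [core_weight]
    change _ * suspWeight b c x.weight s v = _
    rw [suspWeight_of_mem h _ _ v.2, ← hmass, inv_mul_cancel_left₀ hpos.ne']
  change toSuspFun h (ofSuspPoint h x s) = .mk _ (.inl (x, Suspension.stretch 1 s))
  rw [toSuspFun_of_pos h _ hpos, hcore, hheight]

end GeomRealization

theorem mainTheorem4 {V : Type*} (G : SimpleGraph V) {a d : V} (P : G.Walk a d)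
    (hP : P.IsPath) (hlen : P.length = 3)
    (hdeg : ∀ v ∈ P.support, v ≠ a → v ≠ d → (G.neighborSet v).encard = 2)
    (had : G.Adj a d) :
    Nonempty (ContinuousMap.HomotopyEquiv
      (GeomRealization G.indComplex)
      (Suspension (GeomRealization (G.induce {v | v ∉ P.support}).indComplex))) := by
  obtain ⟨b, c, h⟩ := SimpleGraph.IsFoldableSquare.of_path G P hP hlen hdeg had
  exact ⟨{  toFun := GeomRealization.toSusp h
            invFun := GeomRealization.ofSusp h
            left_inv := GeomRealization.ofSusp_comp_toSusp_homotopic h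
            right_inv := Suspension.stretchMap_one_homotopic _ _
              (GeomRealization.toSusp_ofSusp h) }⟩
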